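/- Let $1<p\le 2$ and let $H$ be a complex Hilbert space with bounded operators $B(H)$, ordered by $A\le B$ iff $B-A$ is positive semi-definite. Infinite sums of operators are taken in the weak operator topology (for positive semi-definite terms this is the same as the strong operator topology). Let $a=(a_1,a_2,\dots)$ be a sequence of positive semi-definite operators in $B(H)$ such that the infinite sum $\sum_{n=1}^\infty a_n^p$ defines a bounded operator on $H$. Then $\sum_{n=1}^\infty\left(\frac1n\sum_{k=1}^n a_k\right)^p$ also defines a bounded operator on $H$, and $$\sum_{n=1}^\infty\left(\frac1n\sum_{k=1}^n a_k\right)^p\le\left(\frac{p}{p-1}\right)^p\sum_{n=1}^\infty a_n^p .$$ The constant $(p/(p-1))^p$ is best possible: if $H\ne\{0\}$ and $C<(p/(p-1))^p$ is a real number, then there is a sequence $a$ of positive semi-definite operators on $H$, with only finitely many non-zero terms, such that both sums $\sum_{n=1}^\infty a_n^p$ and $\sum_{n=1}^\infty\left(\frac1n\sum_{k=1}^n a_k\right)^p$ define bounded operators but the inequality $\sum_{n=1}^\infty\left(\frac1n\sum_{k=1}^n a_k\right)^p\le C\sum_{n=1}^\infty a_n^p$ fails. -/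

import Mathlib

/-- Convergence of an infinite sum of bounded operators on a Hilbert space to a bounded operator,
in the weak operator topology. (For positive semi-definite terms the order of summation is
irrelevant, and this is the same as convergence in the strong operator topology.) -/
def HasOperatorSum {H : Type*} [NormedAddCommGroup H] [InnerProductSpace ℂ H]
    (b : ℕ → H →L[ℂ] H) (S : H →L[ℂ] H) : Prop :=
  HasSum (fun n : ℕ => (ContinuousLinearMapWOT.ofCLM (b n) : H →WOT[ℂ] H))
    (ContinuousLinearMapWOT.ofCLM S)

/-- The Hardy (arithmetic averaging) operator applied to a sequence of bounded operators. Sequences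
are indexed from zero: `a k` is the `(k + 1)`-st term, so that the value at `n` is the average of
the first `n + 1` terms. -/
noncomputable def hardyMean {H : Type*} [NormedAddCommGroup H] [InnerProductSpace ℂ H]
    (a : ℕ → H →L[ℂ] H) (n : ℕ) : H →L[ℂ] H :=
  ((n : ℝ) + 1)⁻¹ • ∑ k ∈ Finset.range (n + 1), a k

/-!
The inequality reduces to a Schur test because `t ↦ t ^ p` is operator convex for `1 < p ≤ 2`
(`convexOn_cfc_rpow`). Put `r = 1 - 1 / p` and `u k = (k + 1) ^ r - k ^ r`, so that
`u 0 + ⋯ + u n = (n + 1) ^ r`. Jensen's inequality with the weights `u k / (n + 1) ^ r` gives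
(`hardyMean_rpow_le`)

`hardyMean a n ^ p ≤ ∑ k ≤ n, (u k ^ (1 - p) * (n + 1) ^ (-1 - r)) • a k ^ p`.

Summing over `n`, the coefficient of `a k ^ p` is at most `r ^ (-p) = (p / (p - 1)) ^ p`, exactly
the sharp constant (`rpow_sub_rpow_mul_sum_Ico_le`). This works without loss because `u k` and
`(n + 1) ^ (-1 - r)` are compared with midpoint values: for a function with convex derivative, the
increment over an interval is at least the length times the derivative at the midpoint. The first
comparison bounds `u k` below by `r * (k + 1 / 2) ^ (r - 1)`, the second bounds the tail
`∑ n ≥ k, (n + 1) ^ (-1 - r)` by `r⁻¹ * (k + 1 / 2) ^ (-r)`, and the powers of `k + 1 / 2` cancel.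

The partial sums of `hardyMean a n ^ p` are therefore bounded by a fixed operator, and a series of
positive operators with bounded partial sums converges
(`exists_hasOperatorSum_of_sum_le`), even strongly, since `‖P x‖ ^ 2 ≤ ‖P‖ * ⟪x, P x⟫` for `0 ≤ P`.

For sharpness, take the scalar operators `a k = (k + 1) ^ (-1 / p) • 1`, cut off at `k = N`. Then
`(n + 1) * hardyMean a n ^ p` tends to `(p / (p - 1)) ^ p` before the cut-off, while
`∑ a k ^ p` is a harmonic sum, which diverges as `N → ∞`
(`exists_harmonic_lt_sum_mean_rpow`).
-/

/-! ### Operator convexity of powers -/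

open Set CFC MeasureTheory in
theorem convexOn_cfc_rpowIntegrand₁₂ {A : Type*} [CStarAlgebra A] [PartialOrder A]
    [StarOrderedRing A] {p t : ℝ} (ht : 0 < t) :
    ConvexOn ℝ (Ici (0 : A)) (cfc (Real.rpowIntegrand₁₂ p t)) := by
  have h₁ : (Ici (0 : A)).EqOn (cfc (Real.rpowIntegrand₁₂ p t))
      (fun x : A => t ^ (p - 1) • (t⁻¹ • x + t • Ring.inverse (algebraMap ℝ A t + x)
        - algebraMap ℝ A 1)) := by
    intro x hx
    have hspectrum : ∀ r ∈ spectrum ℝ x, t + r ≠ 0 := by grind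
    have hg : ContinuousOn (fun z : ℝ => (t + z)⁻¹) (spectrum ℝ x) :=
      (continuousOn_const.add continuousOn_id).inv₀ hspectrum
    have hg' : ContinuousOn (fun z : ℝ => t * (t + z)⁻¹) (spectrum ℝ x) :=
      continuousOn_const.mul hg
    have hl : ContinuousOn (fun z : ℝ => t⁻¹ * z) (spectrum ℝ x) :=
      continuousOn_const.mul continuousOn_id
    have hx' : IsSelfAdjoint x := .of_nonneg hx
    -- The definition of `rpowIntegrand₁₂`, an affine function plus a multiple of `(t + z)⁻¹`.
    change cfc (fun z : ℝ => t ^ (p - 1) * (t⁻¹ * z + t * (t + z)⁻¹ - 1)) x = _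
    rw [cfc_const_mul (t ^ (p - 1)) (fun z : ℝ => t⁻¹ * z + t * (t + z)⁻¹ - 1) x
        ((hl.add hg').sub continuousOn_const),
      cfc_sub (fun z : ℝ => t⁻¹ * z + t * (t + z)⁻¹) (fun _ : ℝ => 1) x (hl.add hg')
        continuousOn_const, cfc_const (1 : ℝ) x hx',
      cfc_add (a := x) (fun z : ℝ => t⁻¹ * z) (fun z : ℝ => t * (t + z)⁻¹) hl hg',
      cfc_const_mul t⁻¹ (fun z : ℝ => z) x continuousOn_id,
      cfc_const_mul t (fun z : ℝ => (t + z)⁻¹) x hg,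
      cfc_inv (fun z : ℝ => t + z) x hspectrum (continuousOn_const.add continuousOn_id) hx',
      cfc_const_add t (fun z : ℝ => z) x continuousOn_id hx', cfc_id' ℝ x hx']
  refine ConvexOn.congr ?_ h₁.symm
  refine ConvexOn.smul (by positivity) (ConvexOn.sub (ConvexOn.add ?_ ?_)
    (concaveOn_const _ (convex_Ici 0)))
  · exact ConvexOn.smul (by positivity) (convexOn_id (convex_Ici 0))
  · exact ConvexOn.smul ht.le <| CStarAlgebra.convexOn_ringInverse_algebraMap_add ht

theorem convexOn_sq_Ici_zero {A : Type*} [CStarAlgebra A] [PartialOrder A]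
    [StarOrderedRing A] : ConvexOn ℝ (Set.Ici (0 : A)) (fun a : A => a ^ 2) := by
  refine ⟨convex_Ici 0, fun x hx y hy s t hs ht hst => ?_⟩
  -- The convexity defect is `(s * t) • (x - y) ^ 2`.
  have hsa : IsSelfAdjoint (x - y) := (IsSelfAdjoint.of_nonneg hx).sub (.of_nonneg hy)
  have hnn : 0 ≤ (s * t) • (x - y) ^ 2 :=
    smul_nonneg (mul_nonneg hs ht) hsa.sq_nonneg
  obtain rfl : t = 1 - s := by linarith
  rw [← sub_nonneg]
  convert hnn using 1
  simp only [sq, mul_add, add_mul, mul_sub, sub_mul, smul_mul_assoc, mul_smul_comm, smul_add,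
    smul_sub]
  module

open Set MeasureTheory in
/-- `a ↦ a ^ p` is operator convex for `1 < p ≤ 2`. For `p < 2` it is an integral of the operator
convex functions `rpowIntegrand₁₂ p t`; the endpoint `p = 2` is elementary. -/
theorem convexOn_cfc_rpow {A : Type*} [CStarAlgebra A] [PartialOrder A] [StarOrderedRing A]
    {p : ℝ} (hp1 : 1 < p) (hp2 : p ≤ 2) :
    ConvexOn ℝ (Ici (0 : A)) (fun a : A => a ^ p) := by
  obtain rfl | hp2 := hp2.eq_or_lt
  · refine convexOn_sq_Ici_zero.congr fun a ha => ?_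
    simpa using (CFC.rpow_natCast a 2 ha).symm
  · lift p to NNReal using by linarith
    have hp : p ∈ Ioo 1 2 := ⟨by exact_mod_cast hp1, by exact_mod_cast hp2⟩
    obtain ⟨μ, hμ⟩ := CFC.exists_measure_nnrpow_eq_integral_cfcₙ_rpowIntegrand₁₂ A hp
    simp_rw [← CFC.nnrpow_eq_rpow (zero_lt_one.trans hp.1)]
    refine ConvexOn.congr ?_ (fun a ha => (hμ a ha).2.symm)
    refine integral_convexOn_of_integrand_ae (convex_Ici _) ?_ fun a ha => (hμ a ha).1
    filter_upwards [ae_restrict_mem measurableSet_Ioi] with t ht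
    refine (convexOn_cfc_rpowIntegrand₁₂ (A := A) (p := p) ht).congr fun a ha => ?_
    refine (cfcₙ_eq_cfc ?_ (Real.rpowIntegrand₁₂_zero ht)).symm
    refine (Real.continuousOn_rpowIntegrand₁₂_uncurry hp1 _ fun z hz => ?_).uncurry_left _ ht
    exact quasispectrum_nonneg_of_nonneg a ha z hz

theorem smul_cfc_rpow_of_nonneg {A : Type*} [CStarAlgebra A] [PartialOrder A] [StarOrderedRing A]
    {c : ℝ} (hc : 0 ≤ c) {p : ℝ} (hp : 0 ≤ p) {a : A} (ha : 0 ≤ a) :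
    (c • a) ^ p = c ^ p • a ^ p := by
  lift c to NNReal using hc
  have hcont : ContinuousOn (fun x : NNReal => x ^ p) (spectrum NNReal a) := by
    exact (NNReal.continuous_rpow_const hp).continuousOn
  change (c • a) ^ p = _
  rw [CFC.rpow_def, CFC.rpow_def]
  rw [← cfc_comp_smul c (fun x : NNReal => x ^ p) a
    (NNReal.continuous_rpow_const hp).continuousOn ha]
  simp only [smul_eq_mul, NNReal.mul_rpow]
  rw [cfc_const_mul (c ^ p) (fun x : NNReal => x ^ p) a hcont]
  rfl

/-! ### Midpoint estimates and the Schur test -/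

/-- One half of the Hermite-Hadamard inequality, for a convex function `f'` with primitive `f`. The
derivative is only needed inside the interval, so that `f'` may blow up at an endpoint. -/
theorem two_mul_mul_deriv_midpoint_le {f f' : ℝ → ℝ} {x h : ℝ} (hh : 0 ≤ h)
    (hf : ContinuousOn f (Set.Icc (x - h) (x + h)))
    (hd : ∀ y ∈ Set.Ioo (x - h) (x + h), HasDerivAt f (f' y) y)
    (hc : ConvexOn ℝ (Set.Ioo (x - h) (x + h)) f') :
    2 * h * f' x ≤ f (x + h) - f (x - h) := by
  -- The difference of the two sides increases with the half-length of the interval.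
  have hmono : MonotoneOn (fun t => f (x + t) - f (x - t) - 2 * t * f' x) (Set.Icc 0 h) := by
    refine monotoneOn_of_hasDerivWithinAt_nonneg (convex_Icc 0 h)
      (f' := fun t => f' (x + t) + f' (x - t) - 2 * f' x) ?_ ?_ ?_
    · refine ((hf.comp (by fun_prop) ?_).sub (hf.comp (by fun_prop) ?_)).sub (by fun_prop)
      · intro t ht; constructor <;> linarith [ht.1, ht.2]
      · intro t ht; constructor <;> linarith [ht.1, ht.2]
    · intro t ht
      rw [interior_Icc] at ht
      have h1 : HasDerivAt (fun t => f (x + t)) (f' (x + t)) t := by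
        simpa using (hd (x + t) ⟨by linarith [ht.1, ht.2], by linarith [ht.1, ht.2]⟩).comp_const_add x t
      have h2 : HasDerivAt (fun t => f (x - t)) (-f' (x - t)) t :=
        (hd (x - t) ⟨by linarith [ht.1, ht.2], by linarith [ht.1, ht.2]⟩).comp_const_sub x t
      have h3 : HasDerivAt (fun t : ℝ => 2 * t * f' x) (2 * f' x) t := by
        simpa using ((hasDerivAt_id t).const_mul 2).mul_const (f' x)
      refine (((h1.sub h2).sub h3).congr_deriv ?_).hasDerivWithinAt
      ring
    · intro t ht
      rw [interior_Icc] at ht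
      have hp : x + t ∈ Set.Ioo (x - h) (x + h) := ⟨by linarith [ht.1, ht.2], by linarith [ht.2]⟩
      have hm : x - t ∈ Set.Ioo (x - h) (x + h) := ⟨by linarith [ht.2], by linarith [ht.1, ht.2]⟩
      have := hc.2 hp hm (show (0 : ℝ) ≤ 1 / 2 by norm_num) (show (0 : ℝ) ≤ 1 / 2 by norm_num)
        (by norm_num)
      simp only [smul_eq_mul] at this
      rw [show 1 / 2 * (x + t) + 1 / 2 * (x - t) = x by ring] at this
      linarith
  have := hmono ⟨le_rfl, hh⟩ ⟨hh, le_rfl⟩ hh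
  simp only [add_zero, sub_zero, sub_self, mul_zero, zero_mul] at this
  linarith

theorem convexOn_rpow_of_nonpos {s : ℝ} (hs : s ≤ 0) :
    ConvexOn ℝ (Set.Ioi 0) fun x : ℝ => x ^ s := by
  have hlog : ConvexOn ℝ (Set.Ioi 0) fun x : ℝ => (-s) • -Real.log x :=
    ConvexOn.smul (neg_nonneg.2 hs) strictConcaveOn_log_Ioi.concaveOn.neg
  have himg : Convex ℝ ((fun x : ℝ => (-s) • -Real.log x) '' Set.Ioi 0) := by
    refine (isPreconnected_Ioi.image _ ?_).ordConnected.convex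
    exact ((Real.continuousOn_log.mono fun x hx => (ne_of_gt hx)).neg).const_smul (-s)
  refine ((convexOn_exp.subset (Set.subset_univ _) himg).comp hlog
    (Real.exp_monotone.monotoneOn _)).congr fun x hx => ?_
  rw [Real.rpow_def_of_pos hx]
  simp [mul_comm]

theorem mul_rpow_midpoint_le_sub {r : ℝ} (hr0 : 0 < r) (hr1 : r ≤ 1) (k : ℕ) :
    r * ((k : ℝ) + 1 / 2) ^ (r - 1) ≤ ((k : ℝ) + 1) ^ r - (k : ℝ) ^ r := by
  have hpos : ∀ y ∈ Set.Ioo ((k : ℝ) + 1 / 2 - 1 / 2) ((k : ℝ) + 1 / 2 + 1 / 2), 0 < y := by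
    intro y hy
    have := k.cast_nonneg (α := ℝ)
    linarith [hy.1]
  have := two_mul_mul_deriv_midpoint_le (f := fun y => y ^ r) (f' := fun y => r * y ^ (r - 1))
    (x := (k : ℝ) + 1 / 2) (h := 1 / 2) (by norm_num)
    (Real.continuous_rpow_const hr0.le).continuousOn
    (fun y hy => Real.hasDerivAt_rpow_const (Or.inl (hpos y hy).ne'))
    (((convexOn_rpow_of_nonpos (by linarith)).smul hr0.le).subset hpos (convex_Ioo _ _))
  convert this using 1
  · ring
  · ring_nf

theorem mul_rpow_le_sub_midpoints {r : ℝ} (hr : 0 < r) (n : ℕ) :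
    r * ((n : ℝ) + 1) ^ (-1 - r) ≤
      ((n : ℝ) + 1 / 2) ^ (-r) - (((n + 1 : ℕ) : ℝ) + 1 / 2) ^ (-r) := by
  have hn := n.cast_nonneg (α := ℝ)
  have hpos : ∀ y ∈ Set.Icc ((n : ℝ) + 1 - 1 / 2) ((n : ℝ) + 1 + 1 / 2), 0 < y := by
    intro y hy
    linarith [hy.1]
  have := two_mul_mul_deriv_midpoint_le (f := fun y => -y ^ (-r))
    (f' := fun y => r * y ^ (-r - 1)) (x := (n : ℝ) + 1) (h := 1 / 2) (by norm_num)
    (fun y hy => (Real.continuousAt_rpow_const y (-r)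
      (Or.inl (hpos y hy).ne')).neg.continuousWithinAt)
    (fun y hy => ((Real.hasDerivAt_rpow_const
      (Or.inl (hpos y (Set.Ioo_subset_Icc_self hy)).ne')).neg).congr_deriv (by ring))
    (((convexOn_rpow_of_nonpos (by linarith)).smul hr.le).subset
      (fun y hy => hpos y (Set.Ioo_subset_Icc_self hy)) (convex_Ioo _ _))
  push_cast
  convert this using 1
  · ring_nf
  · ring_nf

theorem sum_Ico_rpow_le {r : ℝ} (hr : 0 < r) (k N : ℕ) :
    ∑ n ∈ Finset.Ico k N, ((n : ℝ) + 1) ^ (-1 - r) ≤ r⁻¹ * ((k : ℝ) + 1 / 2) ^ (-r) := by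
  rw [inv_mul_eq_div, le_div_iff₀' hr, Finset.mul_sum]
  obtain hN | hN := le_total k N
  · calc ∑ n ∈ Finset.Ico k N, r * ((n : ℝ) + 1) ^ (-1 - r)
        ≤ ∑ n ∈ Finset.Ico k N,
            (((n : ℝ) + 1 / 2) ^ (-r) - (((n + 1 : ℕ) : ℝ) + 1 / 2) ^ (-r)) :=
          Finset.sum_le_sum fun n _ => mul_rpow_le_sub_midpoints hr n
      _ = ((k : ℝ) + 1 / 2) ^ (-r) - ((N : ℝ) + 1 / 2) ^ (-r) := by
          have := Finset.sum_Ico_sub (fun n : ℕ => -((n : ℝ) + 1 / 2) ^ (-r)) hN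
          rw [← neg_sub_neg, ← this]
          exact Finset.sum_congr rfl fun n _ => by ring
      _ ≤ ((k : ℝ) + 1 / 2) ^ (-r) := sub_le_self _ (by positivity)
  · rw [Finset.Ico_eq_empty_of_le hN, Finset.sum_empty]
    positivity

/-- The Schur test behind Hardy's inequality: with the increments of `k ^ (1 - 1 / p)` as weights,
the column sums are bounded by the sharp constant. -/
theorem rpow_sub_rpow_mul_sum_Ico_le {p : ℝ} (hp : 1 < p) (k N : ℕ) :
    (((k : ℝ) + 1) ^ (1 - 1 / p) - (k : ℝ) ^ (1 - 1 / p)) ^ (1 - p) *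
      ∑ n ∈ Finset.Ico k N, ((n : ℝ) + 1) ^ (-1 - (1 - 1 / p)) ≤ (p / (p - 1)) ^ p := by
  have hp0 : 0 < p := by linarith
  set r : ℝ := 1 - 1 / p with hr
  have hr0 : 0 < r := by
    rw [hr, sub_pos, div_lt_one hp0]; exact hp
  have hr1 : r ≤ 1 := by rw [hr]; linarith [one_div_pos.2 hp0]
  have hq : p / (p - 1) = r⁻¹ := by
    rw [hr]; field_simp
  have hk : 0 < (k : ℝ) + 1 / 2 := by positivity
  have hcancel : (r - 1) * (1 - p) + -r = 0 := by
    rw [hr]; field_simp; ring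
  calc _ ≤ (r * ((k : ℝ) + 1 / 2) ^ (r - 1)) ^ (1 - p) * (r⁻¹ * ((k : ℝ) + 1 / 2) ^ (-r)) := by
        refine mul_le_mul ?_ (sum_Ico_rpow_le hr0 k N) (by positivity) (by positivity)
        exact Real.rpow_le_rpow_of_nonpos (by positivity) (mul_rpow_midpoint_le_sub hr0 hr1 k)
          (by linarith)
    _ = r ^ (1 - p) * r⁻¹ *
          (((k : ℝ) + 1 / 2) ^ ((r - 1) * (1 - p)) * ((k : ℝ) + 1 / 2) ^ (-r)) := by
        rw [Real.mul_rpow hr0.le (by positivity), ← Real.rpow_mul hk.le]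
        ring
    _ = (p / (p - 1)) ^ p := by
        rw [← Real.rpow_add hk, hcancel,
          Real.rpow_zero, mul_one, ← Real.rpow_neg_one r, ← Real.rpow_add hr0, hq,
          Real.inv_rpow hr0.le, ← Real.rpow_neg hr0.le]
        congr 1
        ring

theorem inv_mul_rpow_sub_one_le_sum {r : ℝ} (hr0 : 0 < r) (hr1 : r ≤ 1) (n : ℕ) :
    r⁻¹ * (((n : ℝ) + 1) ^ r - 1) ≤ ∑ k ∈ Finset.range (n + 1), ((k : ℝ) + 1) ^ (r - 1) := by
  rw [inv_mul_eq_div, div_le_iff₀' hr0, Finset.mul_sum]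
  have hstep : ∀ k : ℕ, ((k : ℝ) + 1 + 1) ^ r - ((k : ℝ) + 1) ^ r ≤
      r * ((k : ℝ) + 1) ^ (r - 1) := by
    intro k
    have hk : 0 < (k : ℝ) + 1 := by positivity
    have hb := rpow_one_add_le_one_add_mul_self (s := ((k : ℝ) + 1)⁻¹)
      (by linarith [inv_pos.2 hk]) hr0.le hr1
    have he : ((k : ℝ) + 1 + 1) ^ r = ((k : ℝ) + 1) ^ r * (1 + ((k : ℝ) + 1)⁻¹) ^ r := by
      rw [← Real.mul_rpow hk.le (by positivity)]
      congr 1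
      field_simp
    rw [he, Real.rpow_sub_one hk.ne']
    have := mul_le_mul_of_nonneg_left hb (Real.rpow_nonneg hk.le r)
    rw [div_eq_mul_inv]
    linarith
  calc ((n : ℝ) + 1) ^ r - 1 ≤ ((n : ℝ) + 1 + 1) ^ r - 1 := by gcongr; linarith
    _ = ∑ k ∈ Finset.range (n + 1), (((k : ℝ) + 1 + 1) ^ r - ((k : ℝ) + 1) ^ r) := by
        have := Finset.sum_range_sub (fun k : ℕ => ((k : ℝ) + 1) ^ r) (n + 1)
        push_cast at this
        rw [this]
        simp
    _ ≤ _ := Finset.sum_le_sum fun k _ => hstep k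

open Filter Topology in
/-- Hardy's constant cannot be improved for the scalar sequence `(k + 1) ^ (-1 / p)`, `k < N`, as
`N → ∞`: its `p`-th powers sum to a harmonic number. -/
theorem exists_harmonic_lt_sum_mean_rpow {p : ℝ} (hp : 1 < p) {C : ℝ}
    (hC : C < (p / (p - 1)) ^ p) :
    ∃ N : ℕ, C * ∑ n ∈ Finset.range N, 1 / ((n : ℝ) + 1) <
      ∑ n ∈ Finset.range N,
        (((n : ℝ) + 1)⁻¹ * ∑ k ∈ Finset.range (n + 1), ((k : ℝ) + 1) ^ (-1 / p)) ^ p := by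
  have hp0 : 0 < p := by linarith
  obtain ⟨r, hr⟩ : ∃ r, r = 1 - 1 / p := ⟨_, rfl⟩
  have hr0 : 0 < r := by
    rw [hr, sub_pos, div_lt_one hp0]; exact hp
  have hr1 : r ≤ 1 := by rw [hr]; linarith [one_div_pos.2 hp0]
  have hq : p / (p - 1) = r⁻¹ := by
    rw [hr]; field_simp
  have hexp : -1 / p = r - 1 := by rw [hr]; ring
  rw [hq] at hC
  rw [hexp]
  have hlower : ∀ n : ℕ, (r⁻¹ * (1 - ((n : ℝ) + 1) ^ (-r))) ^ p * (1 / ((n : ℝ) + 1)) ≤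
      (((n : ℝ) + 1)⁻¹ * ∑ k ∈ Finset.range (n + 1), ((k : ℝ) + 1) ^ (r - 1)) ^ p := by
    intro n
    have hn : 0 < (n : ℝ) + 1 := by positivity
    have hnr : ((n : ℝ) + 1) ^ (-r) ≤ 1 :=
      Real.rpow_le_one_of_one_le_of_nonpos (by simp) (by linarith)
    have hroot : 1 / ((n : ℝ) + 1) = (((n : ℝ) + 1) ^ (r - 1)) ^ p := by
      rw [← Real.rpow_mul hn.le, ← hexp, div_mul_cancel₀ _ hp0.ne', Real.rpow_neg_one, one_div]
    rw [hroot, ← Real.mul_rpow (mul_nonneg (by positivity) (by linarith)) (by positivity)]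
    refine Real.rpow_le_rpow
      (mul_nonneg (mul_nonneg (by positivity) (by linarith)) (by positivity)) ?_ hp0.le
    refine le_trans (le_of_eq ?_)
      (mul_le_mul_of_nonneg_left (inv_mul_rpow_sub_one_le_sum hr0 hr1 n) (inv_nonneg.2 hn.le))
    rw [Real.rpow_sub_one hn.ne', Real.rpow_neg hn.le]
    field_simp
  have hlim : Tendsto (fun n : ℕ => (r⁻¹ * (1 - ((n : ℝ) + 1) ^ (-r))) ^ p) atTop
      (𝓝 (r⁻¹ ^ p)) := by
    have h1 : Tendsto (fun n : ℕ => ((n : ℝ) + 1) ^ (-r)) atTop (𝓝 0) :=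
      (tendsto_rpow_neg_atTop hr0).comp
        (tendsto_atTop_add_const_right _ _ tendsto_natCast_atTop_atTop)
    have h2 := ((h1.const_sub 1).const_mul r⁻¹).rpow_const (p := p) (Or.inr hp0.le)
    simpa using h2
  -- From `n₀` on, the summands exceed `C' / (n + 1)` for some `C' > C`; the terms before
  -- `n₀` are made up for by the divergence of the harmonic series.
  obtain ⟨C', hCC', hC'⟩ := exists_between hC
  obtain ⟨n₀, hn₀⟩ := eventually_atTop.1 (hlim.eventually_const_lt hC')
  have hCC : 0 < C' - C := sub_pos.2 hCC'
  set h : ℕ → ℝ := fun N => ∑ n ∈ Finset.range N, 1 / ((n : ℝ) + 1)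
  obtain ⟨N, hN, hnN⟩ := ((Real.tendsto_sum_range_one_div_nat_succ_atTop.eventually_gt_atTop
    (C' * h n₀ / (C' - C))).and (eventually_ge_atTop n₀)).exists
  refine ⟨N, ?_⟩
  rw [div_lt_iff₀ hCC] at hN
  calc C * h N < C' * (h N - h n₀) := by
        change _ < h N * _ at hN
        linarith
    _ = ∑ n ∈ Finset.Ico n₀ N, C' * (1 / ((n : ℝ) + 1)) := by
        rw [← Finset.mul_sum, Finset.sum_Ico_eq_sub _ hnN]
    _ ≤ ∑ n ∈ Finset.Ico n₀ N,
          (((n : ℝ) + 1)⁻¹ * ∑ k ∈ Finset.range (n + 1), ((k : ℝ) + 1) ^ (r - 1)) ^ p := by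
        refine Finset.sum_le_sum fun n hn => le_trans ?_ (hlower n)
        exact mul_le_mul_of_nonneg_right (hn₀ n (Finset.mem_Ico.1 hn).1).le (by positivity)
    _ ≤ _ := by
        refine Finset.sum_le_sum_of_subset_of_nonneg ?_ fun n _ _ => by positivity
        intro n hn
        exact Finset.mem_range.2 (Finset.mem_Ico.1 hn).2

/-! ### Sums of positive operators -/

open scoped ComplexOrder InnerProductSpace in
/-- The Loewner order in terms of quadratic forms. The order on `ℂ` makes the right-hand side
include the statement that `⟪x, (B - A) x⟫` is real. -/
theorem le_iff_forall_inner_le {H : Type*} [NormedAddCommGroup H] [InnerProductSpace ℂ H]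
    {A B : H →L[ℂ] H} :
    A ≤ B ↔ ∀ x, ⟪x, A x⟫_ℂ ≤ ⟪x, B x⟫_ℂ := by
  rw [ContinuousLinearMap.le_def]
  constructor
  · intro h x
    simpa [inner_sub_right] using h.inner_nonneg_right x
  · intro h
    rw [ContinuousLinearMap.isPositive_iff_complex]
    intro x
    have h0 : 0 ≤ ⟪x, (B - A) x⟫_ℂ := by simpa [inner_sub_right] using h x
    have h1 : 0 ≤ ⟪(B - A) x, x⟫_ℂ := by
      rw [← inner_conj_symm]; exact star_nonneg_iff.2 h0
    obtain ⟨hre, him⟩ := Complex.nonneg_iff.1 h1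
    exact ⟨Complex.ext rfl him, hre⟩

section OperatorSums

variable {H : Type*} [NormedAddCommGroup H] [InnerProductSpace ℂ H] [CompleteSpace H]
open scoped ComplexOrder InnerProductSpace

theorem hasOperatorSum_iff_inner {b : ℕ → H →L[ℂ] H} {S : H →L[ℂ] H} :
    HasOperatorSum b S ↔ ∀ x y, HasSum (fun n => ⟪y, b n x⟫_ℂ) ⟪y, S x⟫_ℂ := by
  have hsum : ∀ (s : Finset ℕ) (x : H),
      (∑ n ∈ s, (ContinuousLinearMapWOT.ofCLM (b n) : H →WOT[ℂ] H)) x = ∑ n ∈ s, b n x := by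
    intro s x
    induction s using Finset.induction_on with
    | empty => simp
    | insert a s ha ih => simp [Finset.sum_insert ha, ih]
  simp only [HasOperatorSum, HasSum,
    ContinuousLinearMapWOT.tendsto_iff_forall_inner_apply_tendsto, hsum, inner_sum,
    ContinuousLinearMapWOT.ofCLM_apply]

theorem HasOperatorSum.sum_le {b : ℕ → H →L[ℂ] H} {S : H →L[ℂ] H} (hb : ∀ n, 0 ≤ b n)
    (h : HasOperatorSum b S) (s : Finset ℕ) : ∑ n ∈ s, b n ≤ S := by
  rw [le_iff_forall_inner_le]
  intro x
  rw [sum_apply, inner_sum]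
  refine sum_le_hasSum s (fun n _ => ?_) (hasOperatorSum_iff_inner.1 h x x)
  simpa using le_iff_forall_inner_le.1 (hb n) x

theorem HasOperatorSum.le_of_sum_le {b : ℕ → H →L[ℂ] H} {S B : H →L[ℂ] H}
    (h : HasOperatorSum b S) (hB : ∀ s : Finset ℕ, ∑ n ∈ s, b n ≤ B) : S ≤ B := by
  rw [le_iff_forall_inner_le]
  intro x
  refine hasSum_le_of_sum_le (hasOperatorSum_iff_inner.1 h x x) fun s => ?_
  simpa [sum_apply, inner_sum] using le_iff_forall_inner_le.1 (hB s) x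

/-- A consequence of the Cauchy-Schwarz inequality for the positive form `⟪y, P x⟫`, obtained here by
writing `P` as the square of a self-adjoint operator. -/
theorem norm_apply_sq_le_of_nonneg {P : H →L[ℂ] H} (hP : 0 ≤ P) (x : H) :
    ‖P x‖ ^ 2 ≤ ‖P‖ * (⟪x, P x⟫_ℂ).re := by
  obtain ⟨Q, hQ, hQP⟩ : ∃ Q : H →L[ℂ] H, IsSelfAdjoint Q ∧ Q * Q = P :=
    ⟨CFC.sqrt P, IsSelfAdjoint.of_nonneg (CFC.sqrt_nonneg P), CFC.sqrt_mul_sqrt_self P hP⟩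
  have hn : ‖P‖ = ‖Q‖ ^ 2 := by rw [← hQP, hQ.norm_mul_self]
  have hi : (⟪x, P x⟫_ℂ).re = ‖Q x‖ ^ 2 := by
    have hsymm : ⟪Q x, Q x⟫_ℂ = ⟪x, Q (Q x)⟫_ℂ := hQ.isSymmetric x (Q x)
    rw [← hQP, mul_apply_eq_comp, ← hsymm]
    exact inner_self_eq_norm_sq (𝕜 := ℂ) (Q x)
  rw [hn, hi, ← mul_pow, ← hQP]
  gcongr
  exact Q.le_opNorm (Q x)

/-- A series of positive operators with bounded partial sums converges in the weak operator
topology. The convergence is even strong, which is what makes the limit a bounded operator, by the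
Banach-Steinhaus theorem. -/
theorem exists_hasOperatorSum_of_sum_le {b : ℕ → H →L[ℂ] H} {B : H →L[ℂ] H} (hb : ∀ n, 0 ≤ b n)
    (hB : ∀ s : Finset ℕ, ∑ n ∈ s, b n ≤ B) : ∃ T : H →L[ℂ] H, HasOperatorSum b T := by
  have hre : ∀ n x, 0 ≤ (⟪x, b n x⟫_ℂ).re := fun n x => by
    simpa using (Complex.le_def.1 (le_iff_forall_inner_le.1 (hb n) x)).1
  have hquad : ∀ x, Summable fun n => (⟪x, b n x⟫_ℂ).re := fun x => by
    refine summable_of_sum_le (c := (⟪x, B x⟫_ℂ).re) (fun n => hre n x) fun s => ?_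
    have := (Complex.le_def.1 (le_iff_forall_inner_le.1 (hB s) x)).1
    simpa [sum_apply, inner_sum] using this
  have hstrong : ∀ x, Summable fun n => b n x := fun x => by
    rw [summable_iff_vanishing_norm]
    intro ε hε
    obtain ⟨s, hs⟩ := summable_iff_vanishing_norm.1 (hquad x) (ε ^ 2 / (‖B‖ + 1)) (by positivity)
    refine ⟨s, fun t ht => ?_⟩
    have hpos : 0 ≤ ∑ n ∈ t, b n := Finset.sum_nonneg fun n _ => hb n
    have hnorm : ‖∑ n ∈ t, b n‖ ≤ ‖B‖ :=
      CStarAlgebra.norm_le_norm_of_nonneg_of_le hpos (hB t)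
    have h1 := norm_apply_sq_le_of_nonneg hpos x
    have h2 := (le_abs_self _).trans_lt (hs t ht)
    rw [sum_apply, inner_sum, Complex.re_sum] at h1
    have h0 : 0 ≤ ∑ n ∈ t, (⟪x, b n x⟫_ℂ).re := Finset.sum_nonneg fun n _ => hre n x
    -- Here `‖(∑ n ∈ t, b n) x‖ ^ 2 ≤ ‖B‖ * ∑ n ∈ t, ⟪x, b n x⟫ < ε ^ 2`.
    rw [lt_div_iff₀ (by positivity)] at h2
    refine lt_of_pow_lt_pow_left₀ 2 hε.le ?_
    nlinarith [mul_le_mul_of_nonneg_right hnorm h0]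
  have hlim : Filter.Tendsto (fun N x => (∑ n ∈ Finset.range N, b n) x) Filter.atTop
      (nhds fun x => ∑' n, b n x) := by
    rw [tendsto_pi_nhds]
    intro x
    simpa [sum_apply] using (hstrong x).hasSum.tendsto_sum_nat
  refine ⟨continuousLinearMapOfTendsto _ hlim, hasOperatorSum_iff_inner.2 fun x y => ?_⟩
  exact (hstrong x).hasSum.mapL (innerSL ℂ y)

theorem hasOperatorSum_sum_of_support {b : ℕ → H →L[ℂ] H} {s : Finset ℕ}
    (hb : ∀ n ∉ s, b n = 0) : HasOperatorSum b (∑ n ∈ s, b n) := by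
  rw [hasOperatorSum_iff_inner]
  intro x y
  rw [sum_apply, inner_sum]
  exact hasSum_sum_of_ne_finset_zero fun n hn => by simp [hb n hn]

end OperatorSums

/-! ### The Hardy inequality for operators -/

section Hardy

variable {H : Type*} [NormedAddCommGroup H] [InnerProductSpace ℂ H] [CompleteSpace H]

/-- Operator Jensen for the mean, with the increments of `k ^ (1 - 1 / p)` as weights. -/
theorem hardyMean_rpow_le {p : ℝ} (hp1 : 1 < p) (hp2 : p ≤ 2) {a : ℕ → H →L[ℂ] H}
    (ha : ∀ n, 0 ≤ a n) (n : ℕ) :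
    hardyMean a n ^ p ≤ ∑ k ∈ Finset.range (n + 1),
      ((((k : ℝ) + 1) ^ (1 - 1 / p) - (k : ℝ) ^ (1 - 1 / p)) ^ (1 - p) *
        ((n : ℝ) + 1) ^ (-1 - (1 - 1 / p))) • a k ^ p := by
  have hp0 : 0 < p := by linarith
  obtain ⟨r, hr⟩ : ∃ r, r = 1 - 1 / p := ⟨_, rfl⟩
  have hr0 : 0 < r := by
    rw [hr, sub_pos, div_lt_one hp0]; exact hp1
  have hn : 0 < (n : ℝ) + 1 := by positivity
  rw [← hr]
  set u : ℕ → ℝ := fun k => ((k : ℝ) + 1) ^ r - (k : ℝ) ^ r with hu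
  have hu0 : ∀ k, 0 < u k := fun k =>
    sub_pos.2 (Real.rpow_lt_rpow k.cast_nonneg (lt_add_one _) hr0)
  have husum : ∑ k ∈ Finset.range (n + 1), u k = ((n : ℝ) + 1) ^ r := by
    have := Finset.sum_range_sub (fun k : ℕ => (k : ℝ) ^ r) (n + 1)
    push_cast at this
    rw [hu, this, Real.zero_rpow hr0.ne', sub_zero]
  set U : ℝ := ((n : ℝ) + 1) ^ r with hU
  have hU0 : 0 < U := by positivity
  have hmean : hardyMean a n =
      ∑ k ∈ Finset.range (n + 1), (u k / U) • ((((n : ℝ) + 1) * (u k / U))⁻¹ • a k) := by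
    rw [hardyMean, Finset.smul_sum]
    refine Finset.sum_congr rfl fun k _ => ?_
    rw [smul_smul]
    congr 1
    have := (hu0 k).ne'
    field_simp
  rw [hmean]
  refine ((convexOn_cfc_rpow hp1 hp2).map_sum_le (fun k _ => (div_pos (hu0 k) hU0).le) ?_
    (fun k _ => ?_)).trans (le_of_eq (Finset.sum_congr rfl fun k _ => ?_))
  · rw [← Finset.sum_div, husum, div_self hU0.ne']
  · have := hu0 k
    exact smul_nonneg (by positivity) (ha k)
  · have hk := hu0 k
    change (u k / U) • ((((n : ℝ) + 1) * (u k / U))⁻¹ • a k) ^ p = _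
    rw [smul_cfc_rpow_of_nonneg (by positivity) hp0.le (ha k), smul_smul]
    congr 1
    rw [Real.inv_rpow (by positivity), Real.mul_rpow hn.le (by positivity),
      Real.div_rpow hk.le hU0.le, hU, ← Real.rpow_mul hn.le, Real.rpow_sub hk, Real.rpow_one,
      show -1 - r = r * p - r - p by rw [hr]; field_simp; ring, Real.rpow_sub hn, Real.rpow_sub hn]
    have h1 := Real.rpow_pos_of_pos hk p
    field_simp

theorem sum_hardyMean_rpow_le {p : ℝ} (hp1 : 1 < p) (hp2 : p ≤ 2) {a : ℕ → H →L[ℂ] H}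
    (ha : ∀ n, 0 ≤ a n) (N : ℕ) :
    ∑ n ∈ Finset.range N, hardyMean a n ^ p ≤
      (p / (p - 1)) ^ p • ∑ n ∈ Finset.range N, a n ^ p := by
  refine (Finset.sum_le_sum fun n _ => hardyMean_rpow_le hp1 hp2 ha n).trans ?_
  -- Exchange the order of summation over the pairs `k ≤ n < N`.
  rw [Finset.sum_comm' (s' := fun k => Finset.Ico k N) (t' := Finset.range N) (by grind),
    Finset.smul_sum]
  refine Finset.sum_le_sum fun k _ => ?_
  rw [← Finset.sum_smul, ← Finset.mul_sum]
  exact smul_le_smul_of_nonneg_right (rpow_sub_rpow_mul_sum_Ico_le hp1 k N) CFC.rpow_nonneg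

theorem exists_hasOperatorSum_hardyMean {p : ℝ} (hp1 : 1 < p) (hp2 : p ≤ 2) {a : ℕ → H →L[ℂ] H}
    {S : H →L[ℂ] H} (ha : ∀ n, 0 ≤ a n) (hS : HasOperatorSum (fun n => a n ^ p) S) :
    ∃ T : H →L[ℂ] H, HasOperatorSum (fun n => hardyMean a n ^ p) T ∧
      T ≤ (p / (p - 1)) ^ p • S := by
  have hnn : ∀ n, 0 ≤ a n ^ p := fun n => CFC.rpow_nonneg
  have hnn' : ∀ n, 0 ≤ hardyMean a n ^ p := fun n => CFC.rpow_nonneg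
  have hq : 0 ≤ (p / (p - 1)) ^ p :=
    Real.rpow_nonneg (div_nonneg (by linarith) (by linarith)) p
  have hbound : ∀ s : Finset ℕ, ∑ n ∈ s, hardyMean a n ^ p ≤ (p / (p - 1)) ^ p • S := fun s => by
    obtain ⟨N, hN⟩ := s.exists_nat_subset_range
    calc ∑ n ∈ s, hardyMean a n ^ p ≤ ∑ n ∈ Finset.range N, hardyMean a n ^ p :=
          Finset.sum_le_sum_of_subset_of_nonneg hN fun n _ _ => hnn' n
      _ ≤ (p / (p - 1)) ^ p • ∑ n ∈ Finset.range N, a n ^ p := sum_hardyMean_rpow_le hp1 hp2 ha N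
      _ ≤ (p / (p - 1)) ^ p • S := smul_le_smul_of_nonneg_left (hS.sum_le hnn _) hq
  obtain ⟨T, hT⟩ := exists_hasOperatorSum_of_sum_le hnn' hbound
  exact ⟨T, hT, hT.le_of_sum_le hbound⟩

/-! ### Optimality of the constant -/

theorem smul_one_rpow {c : ℝ} (hc : 0 ≤ c) {p : ℝ} (hp : 0 ≤ p) :
    (c • (1 : H →L[ℂ] H)) ^ p = c ^ p • 1 := by
  rw [smul_cfc_rpow_of_nonneg hc hp zero_le_one, CFC.one_rpow]

theorem smul_one_le_smul_one_iff [Nontrivial H] {c d : ℝ} :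
    c • (1 : H →L[ℂ] H) ≤ d • 1 ↔ c ≤ d := by
  refine ⟨fun h => ?_, fun h => smul_le_smul_of_nonneg_right h zero_le_one⟩
  by_contra! hlt
  have h0 : (c - d) • (1 : H →L[ℂ] H) ≤ 0 := by rwa [sub_smul, sub_nonpos]
  have h1 : 0 ≤ (c - d) • (1 : H →L[ℂ] H) := smul_nonneg (sub_pos.2 hlt).le zero_le_one
  exact smul_ne_zero (sub_pos.2 hlt).ne' one_ne_zero (le_antisymm h0 h1)

theorem exists_not_hardyMean_le [Nontrivial H] {p : ℝ} (hp1 : 1 < p) (hp2 : p ≤ 2) {C : ℝ}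
    (hC : C < (p / (p - 1)) ^ p) :
    ∃ (a : ℕ → H →L[ℂ] H) (S T : H →L[ℂ] H), (∀ n, (a n).IsPositive) ∧
      (Function.support a).Finite ∧
      HasOperatorSum (fun n => a n ^ p) S ∧
      HasOperatorSum (fun n => hardyMean a n ^ p) T ∧
      ¬ T ≤ C • S := by
  have hp0 : 0 < p := by linarith
  obtain ⟨N, hN⟩ := exists_harmonic_lt_sum_mean_rpow hp1 hC
  let a : ℕ → H →L[ℂ] H := fun k => if k < N then (((k : ℝ) + 1) ^ (-1 / p)) • 1 else 0
  have ha : ∀ k, 0 ≤ a k := fun k => by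
    simp only [a]
    split_ifs
    · exact smul_nonneg (by positivity) zero_le_one
    · exact le_rfl
  have hsupp : ∀ k ∉ Finset.range N, a k = 0 := fun k hk => by simp_all [a]
  have hS : HasOperatorSum (fun n => a n ^ p) (∑ n ∈ Finset.range N, a n ^ p) :=
    hasOperatorSum_sum_of_support fun k hk => by
      rw [hsupp k hk]; exact CFC.zero_rpow hp0.ne'
  -- The means do not vanish beyond `N`, but their sum exists by the inequality itself.
  obtain ⟨T, hT, -⟩ := exists_hasOperatorSum_hardyMean hp1 hp2 ha hS
  refine ⟨a, _, T, fun n => (ContinuousLinearMap.nonneg_iff_isPositive _).1 (ha n),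
    (Finset.finite_toSet (Finset.range N)).subset fun k hk => ?_, hS, hT, fun hle => ?_⟩
  · by_contra hk'
    exact hk (hsupp k hk')
  · have hapow : ∀ n ∈ Finset.range N, a n ^ p = (1 / ((n : ℝ) + 1)) • 1 := fun n hn => by
      simp only [a, if_pos (Finset.mem_range.1 hn)]
      rw [smul_one_rpow (by positivity) hp0.le, ← Real.rpow_mul (by positivity),
        div_mul_cancel₀ _ hp0.ne', Real.rpow_neg_one, one_div]
    have hmean : ∀ n ∈ Finset.range N, hardyMean a n ^ p = ((((n : ℝ) + 1)⁻¹ *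
        ∑ k ∈ Finset.range (n + 1), ((k : ℝ) + 1) ^ (-1 / p)) ^ p) • 1 := fun n hn => by
      rw [← smul_one_rpow (by positivity) hp0.le, hardyMean, mul_smul, Finset.sum_smul]
      congr 2
      refine Finset.sum_congr rfl fun k hk => if_pos ?_
      have := Finset.mem_range.1 hn
      have := Finset.mem_range.1 hk
      omega
    have hnn : ∀ n, 0 ≤ hardyMean a n ^ p := fun n => CFC.rpow_nonneg
    have h1 := (hT.sum_le hnn (Finset.range N)).trans hle
    rw [Finset.sum_congr rfl hapow, Finset.sum_congr rfl hmean, ← Finset.sum_smul,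
      ← Finset.sum_smul, smul_smul, smul_one_le_smul_one_iff] at h1
    exact hN.not_ge h1

end Hardy

theorem mainTheorem3 {H : Type*} [NormedAddCommGroup H] [InnerProductSpace ℂ H] [CompleteSpace H]
    (p : ℝ) (hp1 : 1 < p) (hp2 : p ≤ 2) :
    (∀ (a : ℕ → H →L[ℂ] H) (S : H →L[ℂ] H), (∀ n, (a n).IsPositive) →
      HasOperatorSum (fun n => a n ^ p) S →
        ∃ T : H →L[ℂ] H, HasOperatorSum (fun n => hardyMean a n ^ p) T ∧
          T ≤ (p / (p - 1)) ^ p • S) ∧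
    (Nontrivial H → ∀ C : ℝ, C < (p / (p - 1)) ^ p →
      ∃ (a : ℕ → H →L[ℂ] H) (S T : H →L[ℂ] H), (∀ n, (a n).IsPositive) ∧
        (Function.support a).Finite ∧
        HasOperatorSum (fun n => a n ^ p) S ∧
        HasOperatorSum (fun n => hardyMean a n ^ p) T ∧
        ¬ T ≤ C • S) :=
  ⟨fun a _ ha hS => exists_hasOperatorSum_hardyMean hp1 hp2
    (fun n => (ContinuousLinearMap.nonneg_iff_isPositive (a n)).2 (ha n)) hS,
    fun _ _ hC => exists_not_hardyMean_le hp1 hp2 hC⟩
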